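/- Let $E$ be a compact metric space, and let $\{S(t)\}_{t\ge 0}$ be a strongly continuous semigroup of positive linear operators on $(C(E),\|\cdot\|_\infty)$ with $S(t)1=1$ (the transition semigroup of a Feller process on $E$), with infinitesimal generator $(A,\mathcal D(A))$. Put $V(t)f=\log S(t)e^f$. Let $D\subseteq\mathcal D(A)$ be a core for $A$ that is a linear subspace, is dense in $C(E)$, is closed under products, and satisfies $\phi\circ f\in D$ whenever $f\in D$ and $\phi$ is smooth on a neighbourhood of the range of $f$. For $f\in D$ put $Hf=e^{-f}A e^{f}$. Suppose that $D$ carries a topology $\tau_D$ such that: (a) $(D,\tau_D)$ is a separable barrelled locally convex Hausdorff space; (b) $\tau_D$ is finer than the sup norm topology; (c) $f\mapsto e^f-1$ and $(f,g)\mapsto fg$ are $\tau_D$-continuous maps $D\to D$ and $D\times D\to D$; (d) $S(t)D\subseteq D$ and $V(t)D\subseteq D$ for all $t\ge0$, and the restrictions of both semigroups to $D$ are strongly continuous for $\tau_D$, i.e. each $S(t)$ and each $V(t)$ is $\tau_D$-continuous on $D$, and $t\mapsto S(t)f$ and $t\mapsto V(t)f$ are $\tau_D$-continuous for every $f\in D$;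 (e) $A:(D,\tau_D)\to(C(E),\|\cdot\|_\infty)$ is continuous; (f) there is a barrel (a closed, convex, balanced, absorbing set) $\mathcal N\subseteq D$ with $\sup_{f\in\mathcal N}\|Hf\|\le 1$ and $\sup_{f\in c\mathcal N}\|Hf\|<\infty$ for every $c>0$. Let $\mathcal P(E)$ be the space of Borel probability measures on $E$ with the weak topology, let $D'$ be the continuous dual of $(D,\tau_D)$, and define $\mathcal L:\mathcal P(E)\times D'\to[0,\infty]$ by $$\mathcal L(\mu,u)=\sup_{f\in D}\Big\{\langle f,u\rangle-\int Hf\,d\mu\Big\}.$$ A continuous path $\mu:[0,\infty)\to\mathcal P(E)$ is called absolutely continuous, $\mu\in\mathcal{AC}$, if there is a weak* measurable $u:[0,\infty)\to D'$ such that for all $f\in D$ and $t\ge0$ one has $\int_0^t|\langle f,u(s)\rangle|\,ds<\infty$ and $\int f\,d\mu(t)-\int f\,d\mu(0)=\int_0^t\langle f,u(s)\rangle\,ds$; such a $u$ is unique up to a Lebesgue null set and is denoted $\dot\mu$. Then for every $M>0$ and $T\ge0$, the set of restrictions to $[0,T]$ of the paths in $$\Big\{\mu\in C([0,\infty),\mathcal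 P(E))\ \Big|\ \mu\in\mathcal{AC},\ \int_0^T\mathcal L(\mu(s),\dot\mu(s))\,ds\le M\Big\}$$ is a compact subset of $C([0,T],\mathcal P(E))$ with the topology of uniform convergence. -/

import Mathlib

open MeasureTheory Filter Topology Set
open scoped NNReal ENNReal ContDiff Pointwise

namespace PathLD

noncomputable section

/-- A conservative Feller semigroup on a compact space `E`: a strongly continuous semigroup of
positive operators on `C(E)` which preserve the constant function `1`. -/
structure FellerSemigroup (E : Type*) [TopologicalSpace E] [CompactSpace E] where
  /-- the operator `S(t)` -/
  op : ℝ≥0 → C(E, ℝ) →L[ℝ] C(E, ℝ)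
  op_zero : op 0 = ContinuousLinearMap.id ℝ C(E, ℝ)
  op_add : ∀ s t, op (s + t) = (op s).comp (op t)
  op_nonneg : ∀ t f, 0 ≤ f → 0 ≤ op t f
  op_one : ∀ t, op t 1 = 1
  continuous_orbit : ∀ f, Continuous fun t => op t f

/-- The function `x ↦ e ^ f(x)`. -/
def expC {E : Type*} [TopologicalSpace E] (f : C(E, ℝ)) : C(E, ℝ) :=
  ⟨fun x => Real.exp (f x), by fun_prop⟩

namespace FellerSemigroup

variable {E : Type*} [TopologicalSpace E] [CompactSpace E] (S : FellerSemigroup E)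

/-- The domain `𝒟(A)` of the infinitesimal generator: those `f` for which
`(S(t) f - f) / t` converges in sup norm as `t ↓ 0`. -/
def domain : Set C(E, ℝ) :=
  {f | DifferentiableWithinAt ℝ (fun t : ℝ => S.op t.toNNReal f) (Ici 0) 0}

/-- The infinitesimal generator, `A f = lim_{t ↓ 0} (S(t) f - f) / t`; meaningful on `domain`. -/
def generator (f : C(E, ℝ)) : C(E, ℝ) :=
  derivWithin (fun t : ℝ => S.op t.toNNReal f) (Ici 0) 0

/-- The Hamiltonian `H f = e ^ (-f) A e ^ f`; meaningful when `e ^ f` is in `domain`. -/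
def hamiltonian (f : C(E, ℝ)) : C(E, ℝ) :=
  expC (-f) * S.generator (expC f)

theorem op_expC_pos (t : ℝ≥0) (f : C(E, ℝ)) (x : E) : 0 < S.op t (expC f) x := by
  have h : 0 ≤ expC f - Real.exp (-‖f‖) • (1 : C(E, ℝ)) := by
    intro y
    have h1 : -‖f‖ ≤ f y := by
      have := f.norm_coe_le_norm y
      rw [Real.norm_eq_abs] at this
      exact (abs_le.mp this).1
    have h2 := Real.exp_le_exp.mpr h1
    simpa [expC] using h2
  have h3 := S.op_nonneg t _ h x
  rw [map_sub, map_smul, S.op_one] at h3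
  have h4 : Real.exp (-‖f‖) ≤ S.op t (expC f) x := by simpa using h3
  exact (Real.exp_pos _).trans_le h4

/-- The nonlinear semigroup `V(t) f = log (S(t) e ^ f)`. -/
def logOp (t : ℝ≥0) (f : C(E, ℝ)) : C(E, ℝ) :=
  ⟨fun x => Real.log (S.op t (expC f) x),
    (S.op t (expC f)).continuous.log fun x => (S.op_expC_pos t f x).ne'⟩

theorem hamiltonian_zero : S.hamiltonian 0 = 0 := by
  have h : expC (0 : C(E, ℝ)) = 1 := by ext x; simp [expC]
  simp [hamiltonian, generator, h, S.op_one]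

end FellerSemigroup

/-- `D` is a core for the generator `A`, is dense in `C(E)`, is closed under products, and is closed
under composition with functions that are smooth on a neighbourhood of the range. -/
structure IsSmoothCore {E : Type*} [TopologicalSpace E] [CompactSpace E] (S : FellerSemigroup E)
    (D : Submodule ℝ C(E, ℝ)) : Prop where
  mem_domain : ∀ f ∈ D, f ∈ S.domain
  dense : Dense (D : Set C(E, ℝ))
  core : ∀ f ∈ S.domain, ∃ g : ℕ → C(E, ℝ), (∀ n, g n ∈ D) ∧ Tendsto g atTop (𝓝 f) ∧
    Tendsto (fun n => S.generator (g n)) atTop (𝓝 (S.generator f))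
  mul_mem : ∀ f ∈ D, ∀ g ∈ D, f * g ∈ D
  comp_mem : ∀ f ∈ D, ∀ φ : ℝ → ℝ, ∀ V : Set ℝ, IsOpen V → range f ⊆ V → ContDiffOn ℝ ∞ φ V →
    ∀ g : C(E, ℝ), (∀ x, g x = φ (f x)) → g ∈ D

theorem IsSmoothCore.exp_sub_one_mem {E : Type*} [TopologicalSpace E] [CompactSpace E]
    {S : FellerSemigroup E} {D : Submodule ℝ C(E, ℝ)} (h : IsSmoothCore S D) {f : C(E, ℝ)}
    (hf : f ∈ D) : expC f - 1 ∈ D :=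
  h.comp_mem f hf (fun r => Real.exp r - 1) univ isOpen_univ (subset_univ _)
    (Real.contDiff_exp.sub contDiff_const).contDiffOn _ fun x => by simp [expC]

/-- The vector space `D ⊆ C(E)` without the topology inherited from the sup norm, so that it can
carry a topology `τ_D` of its own. -/
def CoreSpace {E : Type*} [TopologicalSpace E] (D : Submodule ℝ C(E, ℝ)) : Type _ := D

namespace CoreSpace

variable {E : Type*} [TopologicalSpace E] (D : Submodule ℝ C(E, ℝ))

instance : AddCommGroup (CoreSpace D) := inferInstanceAs (AddCommGroup D)

instance : Module ℝ (CoreSpace D) := inferInstanceAs (Module ℝ D)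

variable {D}

/-- The inclusion `D → C(E)`. -/
def incl : CoreSpace D →ₗ[ℝ] C(E, ℝ) := D.subtype

/-- An element of `D` as an element of `CoreSpace D`. -/
def mk (f : C(E, ℝ)) (hf : f ∈ D) : CoreSpace D := (⟨f, hf⟩ : D)

theorem incl_mem (f : CoreSpace D) : incl f ∈ D := Subtype.property (p := (· ∈ D)) f

@[simp] theorem incl_mk (f : C(E, ℝ)) (hf : f ∈ D) : incl (mk f hf) = f := rfl

end CoreSpace

open CoreSpace

/-- The conditions on the core `D` and on its topology `τ_D`, apart from `(D, τ_D)` being a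
separable barrelled locally convex Hausdorff space. -/
structure IsRegularCore {E : Type*} [TopologicalSpace E] [CompactSpace E] (S : FellerSemigroup E)
    (D : Submodule ℝ C(E, ℝ)) [TopologicalSpace (CoreSpace D)] : Prop extends
    IsSmoothCore S D where
  /-- `τ_D` is finer than the sup norm topology -/
  continuous_incl : Continuous fun f : CoreSpace D => incl f
  /-- `f ↦ e ^ f - 1` is `τ_D`-continuous -/
  continuous_exp : Continuous fun f : CoreSpace D =>
    CoreSpace.mk (expC (incl f) - 1) (toIsSmoothCore.exp_sub_one_mem (incl_mem f))
  /-- multiplication is `τ_D`-continuous -/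
  continuous_mul : Continuous fun p : CoreSpace D × CoreSpace D =>
    CoreSpace.mk (incl p.1 * incl p.2) (toIsSmoothCore.mul_mem _ (incl_mem p.1) _ (incl_mem p.2))
  /-- `S(t)` and `V(t)` map `D` to itself and restrict to strongly continuous semigroups on
  `(D, τ_D)` -/
  op_mem : ∀ t, ∀ f ∈ D, S.op t f ∈ D
  continuous_op : ∀ t, Continuous fun f : CoreSpace D =>
    CoreSpace.mk (S.op t (incl f)) (op_mem t _ (incl_mem f))
  continuous_op_orbit : ∀ f : CoreSpace D, Continuous fun t : ℝ≥0 =>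
    CoreSpace.mk (S.op t (incl f)) (op_mem t _ (incl_mem f))
  logOp_mem : ∀ t, ∀ f ∈ D, S.logOp t f ∈ D
  continuous_logOp : ∀ t, Continuous fun f : CoreSpace D =>
    CoreSpace.mk (S.logOp t (incl f)) (logOp_mem t _ (incl_mem f))
  continuous_logOp_orbit : ∀ f : CoreSpace D, Continuous fun t : ℝ≥0 =>
    CoreSpace.mk (S.logOp t (incl f)) (logOp_mem t _ (incl_mem f))
  /-- `A : (D, τ_D) → C(E)` is continuous -/
  continuous_generator : Continuous fun f : CoreSpace D => S.generator (incl f)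
  /-- there is a barrel on which `‖H f‖ ≤ 1` and on whose multiples `‖H f‖` is bounded -/
  exists_barrel : ∃ N : Set (CoreSpace D),
    Convex ℝ N ∧ Balanced ℝ N ∧ Absorbent ℝ N ∧ IsClosed N ∧
    (∀ f ∈ N, ‖S.hamiltonian (incl f)‖ ≤ 1) ∧
    ∀ c : ℝ, 0 < c → ∃ B : ℝ, ∀ f ∈ c • N, ‖S.hamiltonian (incl f)‖ ≤ B

section Paths

variable {E : Type*} [TopologicalSpace E] [MeasurableSpace E] {D : Submodule ℝ C(E, ℝ)}
  [TopologicalSpace (CoreSpace D)]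

/-- The Lagrangian `𝓛(μ, u) = sup_{f ∈ D} (⟨f, u⟩ - ⟨H f, μ⟩) ∈ [0, ∞]` for `μ ∈ 𝒫(E)`, `u ∈ D'`.
Since `f = 0` contributes the value `0`, replacing the terms by their positive parts does not
change the supremum (see `coe_lagrangian`). -/
def lagrangian [CompactSpace E] (S : FellerSemigroup E) (μ : ProbabilityMeasure E)
    (u : CoreSpace D →L[ℝ] ℝ) : ℝ≥0∞ :=
  ⨆ f : CoreSpace D, ENNReal.ofReal (u f - ∫ x, S.hamiltonian (incl f) x ∂(μ : Measure E))

theorem coe_lagrangian [CompactSpace E] (S : FellerSemigroup E) (μ : ProbabilityMeasure E)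
    (u : CoreSpace D →L[ℝ] ℝ) :
    (lagrangian S μ u : EReal) =
      ⨆ f : CoreSpace D,
        ((u f - ∫ x, S.hamiltonian (incl f) x ∂(μ : Measure E) : ℝ) : EReal) := by
  have h0 : (0 : EReal) ≤ ⨆ f : CoreSpace D,
      ((u f - ∫ x, S.hamiltonian (incl f) x ∂(μ : Measure E) : ℝ) : EReal) := by
    refine le_iSup_of_le (0 : CoreSpace D) ?_
    simp [S.hamiltonian_zero]
  refine le_antisymm ?_ (iSup_le fun f => ?_)
  · rw [← EReal.coe_toENNReal h0, EReal.coe_ennreal_le_coe_ennreal_iff]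
    refine iSup_le fun f => ?_
    rw [← EReal.coe_ennreal_le_coe_ennreal_iff, EReal.coe_toENNReal h0, EReal.coe_ennreal_ofReal]
    refine (EReal.coe_strictMono.monotone.map_max).trans_le (max_le ?_ h0)
    exact le_iSup (fun f : CoreSpace D =>
      ((u f - ∫ x, S.hamiltonian (incl f) x ∂(μ : Measure E) : ℝ) : EReal)) f
  · refine le_trans ?_ (EReal.coe_ennreal_le_coe_ennreal_iff.mpr (le_iSup (fun f : CoreSpace D =>
      ENNReal.ofReal (u f - ∫ x, S.hamiltonian (incl f) x ∂(μ : Measure E))) f))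
    rw [EReal.coe_ennreal_ofReal]
    exact EReal.coe_le_coe_iff.mpr (le_max_left _ _)

variable [BorelSpace E]

/-- `u : [0, ∞) → D'` is a velocity of the path `ν` in `𝒫(E)`: `s ↦ ⟨f, u(s)⟩` is measurable and
locally integrable for every `f ∈ D`, and `ν(t) - ν(0) = ∫₀ᵗ u(s) ds` as a Gelfand integral
in `D'`. (Only the values `u(s)` with `s ≥ 0` matter.) -/
def IsVelocity (ν : C(ℝ≥0, ProbabilityMeasure E)) (u : ℝ → CoreSpace D →L[ℝ] ℝ) : Prop :=
  (∀ f : CoreSpace D, ∀ t : ℝ≥0, IntegrableOn (fun s => u s f) (Icc 0 t)) ∧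
  ∀ t : ℝ≥0, ∀ f : CoreSpace D,
    ∫ x, incl f x ∂(ν t : Measure E) - ∫ x, incl f x ∂(ν 0 : Measure E) =
      ∫ s in (0 : ℝ)..t, u s f

/-- The velocity of an absolutely continuous path is unique up to a null set of times. -/
theorem IsVelocity.ae_eq [TopologicalSpace.SeparableSpace (CoreSpace D)]
    {ν : C(ℝ≥0, ProbabilityMeasure E)} {u v : ℝ → CoreSpace D →L[ℝ] ℝ}
    (hu : IsVelocity ν u) (hv : IsVelocity ν v) : ∀ᵐ s : ℝ, 0 < s → u s = v s := by
  have key : ∀ f : CoreSpace D, ∀ n : ℕ, ∀ᵐ s : ℝ, s ∈ Ioo (0 : ℝ) n → u s f = v s f := by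
    intro f n
    have iu : IntervalIntegrable (fun s => u s f) volume 0 n :=
      (intervalIntegrable_iff_integrableOn_Icc_of_le n.cast_nonneg).2 (hu.1 f n)
    have iv : IntervalIntegrable (fun s => v s f) volume 0 n :=
      (intervalIntegrable_iff_integrableOn_Icc_of_le n.cast_nonneg).2 (hv.1 f n)
    filter_upwards [iu.ae_hasDerivAt_integral, iv.ae_hasDerivAt_integral] with s h1 h2 hs
    have hm : s ∈ uIcc (0 : ℝ) n := by
      rw [uIcc_of_le n.cast_nonneg]; exact Ioo_subset_Icc_self hs
    have e1 := h1 hm 0 left_mem_uIcc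
    have e2 := h2 hm 0 left_mem_uIcc
    refine e1.unique (e2.congr_of_eventuallyEq ?_)
    filter_upwards [lt_mem_nhds hs.1] with t ht
    have a := hu.2 ⟨t, ht.le⟩ f
    have b := hv.2 ⟨t, ht.le⟩ f
    exact a.symm.trans b
  have key2 : ∀ᵐ s : ℝ, ∀ k n : ℕ, s ∈ Ioo (0 : ℝ) n →
      u s (TopologicalSpace.denseSeq (CoreSpace D) k) =
        v s (TopologicalSpace.denseSeq (CoreSpace D) k) :=
    ae_all_iff.2 fun k => ae_all_iff.2 fun n => key _ n
  filter_upwards [key2] with s hs h0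
  obtain ⟨n, hn⟩ := exists_nat_gt s
  refine DFunLike.coe_injective ((u s).continuous.ext_on
    (TopologicalSpace.denseRange_denseSeq _) (v s).continuous ?_)
  rintro _ ⟨k, rfl⟩
  exact hs k n ⟨h0, hn⟩

/-- The set of absolutely continuous paths `ν : [0, ∞) → 𝒫(E)`, with velocity `ν̇ = u`, such that
`∫₀ᵀ 𝓛(ν(s), ν̇(s)) ds ≤ M`. By `IsVelocity.ae_eq` the choice of `u` is immaterial when `D` is
separable. -/
def levelSet [CompactSpace E] (S : FellerSemigroup E) (D : Submodule ℝ C(E, ℝ))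
    [TopologicalSpace (CoreSpace D)] (M : ℝ) (T : ℝ≥0) :
    Set C(ℝ≥0, ProbabilityMeasure E) :=
  {ν | ∃ u : ℝ → CoreSpace D →L[ℝ] ℝ, IsVelocity ν u ∧
    ∫⁻ s in Icc (0 : ℝ) T, lagrangian S (ν s.toNNReal) (u s) ≤ ENNReal.ofReal M}

end Paths

end

end PathLD

/-!
A path `γ` that is constant after `T` has action at most `M` on `[0, T]` if and only if there is a
nondecreasing `Φ` with `Φ T - Φ 0 ≤ M` such that, for all `f` and `0 ≤ s ≤ t ≤ T`,
`⟨f, γ t⟩ - ⟨f, γ s⟩ - ∫ₛᵗ H f (γ r) dr ≤ Φ t - Φ s`.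
Given a velocity, one takes for `Φ` the primitive of the Lagrangian. Conversely, applying the
inequality to `± c f` gives `c |⟨f, γ t⟩ - ⟨f, γ s⟩| ≤ Φ t - Φ s + K(c, f) (t - s)` for every
`c > 0`, so that `t ↦ ⟨f, γ t⟩` is absolutely continuous. By separability, at almost every time
`s` these functions have a derivative `δ f` for all `f` in a dense subspace, and
`δ f - H f (γ s) ≤ Φ' s` there. As `f ↦ H f (γ s)` is continuous, `δ` is bounded above near `0`,
hence continuous; its extension `u s` to the whole space satisfies
`sup_f (⟨f, u s⟩ - H f (γ s)) ≤ Φ' s`, and `∫ Φ' ≤ Φ T - Φ 0`.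

The inequality is closed under pointwise limits of `(γ, Φ)`, the functions `Φ` range over the
compact space `[0, M]^ℝ`, and the superlinear modulus above confines `γ` to a compact set by
Arzelà–Ascoli. So the sublevel set is a continuous image of a compact set of pairs.
-/

namespace PathLD

section FunctionalExtension

variable {V : Type*} [AddCommGroup V] [Module ℝ V] [TopologicalSpace V]
  [IsTopologicalAddGroup V] [ContinuousSMul ℝ V]

theorem continuous_linearMap_of_forall_mem_nhds_zero_le {δ : V →ₗ[ℝ] ℝ} {U : Set V} {C : ℝ}
    (hU : U ∈ 𝓝 0) (hδ : ∀ f ∈ U, δ f ≤ C) : Continuous δ := by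
  have hbdd : Bornology.IsBounded (δ '' (U ∩ -U)) := by
    refine Metric.isBounded_Icc (-C) C |>.subset ?_
    rintro _ ⟨f, ⟨hf, hnf⟩, rfl⟩
    have := hδ (-f) hnf
    rw [map_neg] at this
    exact ⟨by linarith, hδ f hf⟩
  exact (δ.clmOfExistsBoundedImage ⟨U ∩ -U, inter_mem hU (neg_mem_nhds_zero V hU),
    NormedSpace.isVonNBounded_of_isBounded ℝ hbdd⟩).continuous

theorem exists_continuousLinearMap_extending {δ : V →ₗ.[ℝ] ℝ} (hdense : Dense (δ.domain : Set V))
    (hδ : Continuous δ) : ∃ u : V →L[ℝ] ℝ, ∀ f : δ.domain, u f = δ f := by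
  let _ := IsTopologicalAddGroup.rightUniformSpace V
  have : IsUniformAddGroup V := isUniformAddGroup_of_addCommGroup
  have : IsUniformAddGroup δ.domain := δ.domain.toAddSubgroup.isUniformAddGroup
  exact ⟨(⟨δ.toFun, hδ⟩ : δ.domain →L[ℝ] ℝ).extend δ.domain.subtypeL,
    ContinuousLinearMap.extend_eq _ hdense.denseRange_val ⟨rfl⟩⟩

end FunctionalExtension

section AbsoluteContinuity

open AbsolutelyContinuousOnInterval (disjWithin)

variable {Y : Type*} [PseudoMetricSpace Y]

theorem sum_dist_le_dist_of_mem_disjWithin {a b : ℝ} {I : ℕ × (ℕ → ℝ × ℝ)}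
    (hI : I ∈ disjWithin a b) :
    ∑ i ∈ Finset.range I.1, dist (I.2 i).1 (I.2 i).2 ≤ dist a b := by
  have hvol : ∀ x y : ℝ, volume.real (uIoc x y) = dist x y := fun x y => by
    rw [uIoc, Real.volume_real_Ioc_of_le min_le_max, Real.dist_eq, max_sub_min_eq_abs']
  simp_rw [← hvol]
  rw [← measureReal_biUnion_finset hI.2 (fun _ _ => measurableSet_uIoc) fun _ _ => by simp [uIoc]]
  exact measureReal_mono (AbsolutelyContinuousOnInterval.biUnion_uIoc_subset_of_mem_disjWithin hI)
    (by simp [uIoc])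

theorem image_mem_disjWithin {Φ : ℝ → ℝ} {a b : ℝ} (hΦ : MonotoneOn Φ (uIcc a b))
    {I : ℕ × (ℕ → ℝ × ℝ)} (hI : I ∈ disjWithin a b) :
    (I.1, fun i => (Φ (I.2 i).1, Φ (I.2 i).2)) ∈ disjWithin (Φ a) (Φ b) := by
  have hmin {x y : ℝ} (hx : x ∈ uIcc a b) (hy : y ∈ uIcc a b) : min x y ∈ uIcc a b :=
    min_rec' (· ∈ uIcc a b) hx hy
  have hmax {x y : ℝ} (hx : x ∈ uIcc a b) (hy : y ∈ uIcc a b) : max x y ∈ uIcc a b :=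
    max_rec' (· ∈ uIcc a b) hx hy
  refine ⟨fun i hi => ⟨hΦ.mapsTo_uIcc (hI.1 i hi).1, hΦ.mapsTo_uIcc (hI.1 i hi).2⟩,
    fun i hi j hj hij => ?_⟩
  obtain ⟨hi₁, hi₂⟩ := hI.1 i hi
  obtain ⟨hj₁, hj₂⟩ := hI.1 j hj
  have hdisj := Ioc_disjoint_Ioc.1 (hI.2 hi hj hij)
  rw [Function.onFun, uIoc, uIoc, Ioc_disjoint_Ioc, ← hΦ.map_min hi₁ hi₂, ← hΦ.map_max hi₁ hi₂,
    ← hΦ.map_min hj₁ hj₂, ← hΦ.map_max hj₁ hj₂, ← hΦ.map_min (hmax hi₁ hi₂) (hmax hj₁ hj₂),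
    ← hΦ.map_max (hmin hi₁ hi₂) (hmin hj₁ hj₂)]
  exact hΦ (hmin (hmax hi₁ hi₂) (hmax hj₁ hj₂)) (hmax (hmin hi₁ hi₂) (hmin hj₁ hj₂)) hdisj

theorem absolutelyContinuousOnInterval_of_mul_dist_le {F : ℝ → Y} {Φ : ℝ → ℝ} {a b : ℝ}
    (hΦ : MonotoneOn Φ (uIcc a b))
    (hF : ∀ c > 0, ∃ K : ℝ, ∀ s ∈ uIcc a b, ∀ t ∈ uIcc a b,
      c * dist (F s) (F t) ≤ dist (Φ s) (Φ t) + K * dist s t) :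
    AbsolutelyContinuousOnInterval F a b := by
  rw [absolutelyContinuousOnInterval_iff]
  intro ε hε
  set R := dist (Φ a) (Φ b) + 1
  have hR : 0 < R := by positivity
  obtain ⟨K, hK⟩ := hF (R / ε) (by positivity)
  refine ⟨1 / (|K| + 1), by positivity, fun I hI hlen => ?_⟩
  have hsum : R / ε * ∑ i ∈ Finset.range I.1, dist (F (I.2 i).1) (F (I.2 i).2) ≤
      dist (Φ a) (Φ b) + K * ∑ i ∈ Finset.range I.1, dist (I.2 i).1 (I.2 i).2 := by
    grw [← sum_dist_le_dist_of_mem_disjWithin (image_mem_disjWithin hΦ hI)]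
    rw [Finset.mul_sum, Finset.mul_sum, ← Finset.sum_add_distrib]
    exact Finset.sum_le_sum fun i hi => hK _ (hI.1 i hi).1 _ (hI.1 i hi).2
  have hshort : K * ∑ i ∈ Finset.range I.1, dist (I.2 i).1 (I.2 i).2 < 1 := by
    rw [lt_div_iff₀ (by positivity)] at hlen
    have := Finset.sum_nonneg fun i (_ : i ∈ Finset.range I.1) =>
      dist_nonneg (x := (I.2 i).1) (y := (I.2 i).2)
    nlinarith [le_abs_self K]
  have := hsum.trans_lt ((add_lt_add_iff_left _).2 hshort)
  rwa [div_mul_eq_mul_div, div_lt_iff₀ hε, mul_lt_mul_iff_right₀ hR] at this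

end AbsoluteContinuity

section Differentiability

variable {F : ℝ → ℝ} {a b : ℝ}

theorem ae_restrict_Ioo_differentiableAt_of_absolutelyContinuous
    (hF : AbsolutelyContinuousOnInterval F a b) :
    ∀ᵐ s ∂volume.restrict (Ioo a b), DifferentiableAt ℝ F s := by
  rw [ae_restrict_iff' measurableSet_Ioo]
  filter_upwards [hF.ae_differentiableAt] with s hs hsab
  exact hs (Icc_subset_uIcc (Ioo_subset_Icc_self hsab))

theorem ae_restrict_Ioo_differentiableAt_of_monotoneOn (hF : MonotoneOn F (Icc a b)) :
    ∀ᵐ s ∂volume.restrict (Ioo a b), DifferentiableAt ℝ F s := by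
  filter_upwards [(hF.mono Ioo_subset_Icc_self).ae_differentiableWithinAt measurableSet_Ioo,
    ae_restrict_mem measurableSet_Ioo] with s hs hsab
  exact hs.differentiableAt (Ioo_mem_nhds hsab.1 hsab.2)

theorem lintegral_ofReal_deriv_le (hab : a ≤ b) (hF : MonotoneOn F (Icc a b)) :
    ∫⁻ s in Ioo a b, ENNReal.ofReal (deriv F s) ≤ ENNReal.ofReal (F b - F a) := by
  have hnonneg : ∀ᵐ s ∂volume.restrict (Ioo a b), 0 ≤ deriv F s := by
    filter_upwards [ae_restrict_mem measurableSet_Ioo] with s hs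
    rw [← derivWithin_of_mem_nhds (Icc_mem_nhds hs.1 hs.2)]
    exact hF.derivWithin_nonneg
  have hmono := hF (left_mem_Icc.2 hab) (right_mem_Icc.2 hab) hab
  rw [← uIcc_of_le hab] at hF
  have hle := hF.intervalIntegral_deriv_mem_uIcc
  rw [uIcc_of_le (sub_nonneg.2 hmono), intervalIntegral.integral_of_le hab,
    integral_Ioc_eq_integral_Ioo] at hle
  rw [← ofReal_integral_eq_lintegral_ofReal
    ((intervalIntegrable_iff_integrableOn_Ioo_of_le hab).1 hF.intervalIntegrable_deriv) hnonneg]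
  exact ENNReal.ofReal_le_ofReal hle.2

end Differentiability

section Integral

theorem integral_le_toReal_lintegral_ofReal {α : Type*} [MeasurableSpace α] {μ : Measure α}
    {g : α → ℝ} (hg : Integrable g μ) : ∫ x, g x ∂μ ≤ (∫⁻ x, ENNReal.ofReal (g x) ∂μ).toReal := by
  rw [integral_eq_lintegral_pos_part_sub_lintegral_neg_part hg]
  exact sub_le_self _ ENNReal.toReal_nonneg

theorem setLIntegral_Icc_add_Ioc {α : Type*} [LinearOrder α] [TopologicalSpace α]
    [OrderClosedTopology α] [MeasurableSpace α] [OpensMeasurableSpace α] {μ : Measure α}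
    (ℓ : α → ℝ≥0∞) {a s t : α} (has : a ≤ s) (hst : s ≤ t) :
    (∫⁻ r in Icc a s, ℓ r ∂μ) + ∫⁻ r in Ioc s t, ℓ r ∂μ = ∫⁻ r in Icc a t, ℓ r ∂μ := by
  rw [← Icc_union_Ioc_eq_Icc has hst, lintegral_union measurableSet_Ioc]
  exact (Iic_disjoint_Ioc le_rfl).mono_left Icc_subset_Iic_self

end Integral

section Domination

variable {V X : Type*} [AddCommGroup V] [Module ℝ V] [TopologicalSpace X]

/-- A path `γ` is dominated by a primitive `Φ` of its action: this integrated form of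
`legendre H (γ t) (γ̇ t) ≤ Φ' t` mentions no derivative of `γ` and is closed under pointwise
limits. -/
structure DominatesAction (p : V →ₗ[ℝ] C(X, ℝ)) (H : V → C(X, ℝ)) (J : Set ℝ) (γ : C(ℝ, X))
    (Φ : ℝ → ℝ) : Prop where
  monotoneOn : MonotoneOn Φ J
  sub_sub_integral_le : ∀ f, ∀ s ∈ J, ∀ t ∈ J, s ≤ t →
    p f (γ t) - p f (γ s) - ∫ r in s..t, H f (γ r) ≤ Φ t - Φ s

/-- The functional `f ↦ d/dt p f (γ t)` at time `s`, defined on those `f` for which this derivative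
exists. -/
noncomputable def derivAlong (p : V →ₗ[ℝ] C(X, ℝ)) (γ : C(ℝ, X)) (s : ℝ) : V →ₗ.[ℝ] ℝ where
  domain :=
    { carrier := {f | DifferentiableAt ℝ (fun t => p f (γ t)) s}
      zero_mem' := by simp
      add_mem' := fun hf hg => by simpa using DifferentiableAt.fun_add hf hg
      smul_mem' := fun c _ hf => by simpa using DifferentiableAt.const_mul hf c }
  toFun :=
    { toFun := fun f => deriv (fun t => p f (γ t)) s
      map_add' := fun f g => by simpa using deriv_fun_add f.2 g.2
      map_smul' := fun c f => by simp }

namespace DominatesAction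

variable {p : V →ₗ[ℝ] C(X, ℝ)} {H : V → C(X, ℝ)} {J : Set ℝ} {γ : C(ℝ, X)} {Φ : ℝ → ℝ}

theorem deriv_sub_le_deriv (h : DominatesAction p H J γ Φ) {s : ℝ} (hs : J ∈ 𝓝 s) {f : V}
    (hf : DifferentiableAt ℝ (fun t => p f (γ t)) s) (hΦ : DifferentiableAt ℝ Φ s) :
    deriv (fun t => p f (γ t)) s - H f (γ s) ≤ deriv Φ s := by
  have hcont : Continuous fun r => H f (γ r) := by fun_prop
  have hmono : MonotoneOn (fun t => Φ t - p f (γ t) + ∫ r in s..t, H f (γ r)) J := by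
    intro a ha b hb hab
    have hint : (∫ r in s..a, H f (γ r)) + ∫ r in a..b, H f (γ r) = ∫ r in s..b, H f (γ r) :=
      intervalIntegral.integral_add_adjacent_intervals (hcont.intervalIntegrable _ _)
        (hcont.intervalIntegrable _ _)
    linarith [h.sub_sub_integral_le f a ha b hb hab]
  have hderiv := (hΦ.hasDerivAt.fun_sub hf.hasDerivAt).fun_add
    (hcont.integral_hasStrictDerivAt s s).hasDerivAt
  have hnonneg := hmono.derivWithin_nonneg (x := s)
  rw [derivWithin_of_mem_nhds hs, hderiv.deriv] at hnonneg
  linarith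

section Compact

variable [CompactSpace X]

theorem sub_le (h : DominatesAction p H J γ Φ) (f : V) {s t : ℝ} (hs : s ∈ J) (ht : t ∈ J)
    (hst : s ≤ t) : p f (γ t) - p f (γ s) ≤ Φ t - Φ s + ‖H f‖ * (t - s) := by
  have hint : ∫ r in s..t, H f (γ r) ≤ ‖H f‖ * (t - s) := by
    have := intervalIntegral.norm_integral_le_of_norm_le_const (a := s) (b := t)
      fun r _ => (H f).norm_coe_le_norm (γ r)
    rw [abs_of_nonneg (sub_nonneg.2 hst)] at this
    exact (Real.le_norm_self _).trans this
  linarith [h.sub_sub_integral_le f s hs t ht hst]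

theorem mul_dist_le (h : DominatesAction p H J γ Φ) {c : ℝ} (hc : 0 < c) (f : V) {s t : ℝ}
    (hs : s ∈ J) (ht : t ∈ J) :
    c * dist (p f (γ s)) (p f (γ t)) ≤
      dist (Φ s) (Φ t) + max ‖H (c • f)‖ ‖H (-(c • f))‖ * dist s t := by
  wlog hst : s ≤ t generalizing s t
  · simpa only [dist_comm] using this ht hs (le_of_not_ge hst)
  have hlen : 0 ≤ t - s := sub_nonneg.2 hst
  have hΦ : dist (Φ s) (Φ t) = Φ t - Φ s := by
    rw [dist_comm, Real.dist_eq, abs_of_nonneg (sub_nonneg.2 (h.monotoneOn hs ht hst))]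
  have hdist : dist s t = t - s := by
    rw [dist_comm, Real.dist_eq, abs_of_nonneg hlen]
  have hpos := h.sub_le (c • f) hs ht hst
  have hneg := h.sub_le (-(c • f)) hs ht hst
  grw [le_max_left ‖H (c • f)‖ ‖H (-(c • f))‖] at hpos
  grw [le_max_right ‖H (c • f)‖ ‖H (-(c • f))‖] at hneg
  simp only [map_neg, map_smul, ContinuousMap.neg_apply, ContinuousMap.smul_apply,
    smul_eq_mul] at hpos hneg
  rw [hΦ, hdist, dist_comm, Real.dist_eq, ← abs_of_pos hc, ← abs_mul, abs_le, abs_of_pos hc]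
  constructor <;> linarith

theorem absolutelyContinuousOnInterval {a b : ℝ} (hab : a ≤ b)
    (h : DominatesAction p H (Icc a b) γ Φ) (f : V) :
    AbsolutelyContinuousOnInterval (fun t => p f (γ t)) a b := by
  rw [← uIcc_of_le hab] at h
  exact absolutelyContinuousOnInterval_of_mul_dist_le h.monotoneOn fun _ hc =>
    ⟨_, fun _ hs _ ht => h.mul_dist_le hc f hs ht⟩

end Compact

end DominatesAction

end Domination

section Action

variable {V X : Type*} [AddCommGroup V] [Module ℝ V] [TopologicalSpace V] [TopologicalSpace X]

/-- The Legendre transform `u ↦ sup_f (⟨f, u⟩ - H f x)` of `f ↦ H f x`, with values in `[0, ∞]`: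
it is truncated below at `0`, which changes nothing when `H 0 x = 0`. -/
noncomputable def legendre (H : V → C(X, ℝ)) (x : X) (u : V →L[ℝ] ℝ) : ℝ≥0∞ :=
  ⨆ f, ENNReal.ofReal (u f - H f x)

/-- `u` is a derivative of the path `γ` seen through the linear family of coordinates `p`: for every
`f`, the function `t ↦ p f (γ t)` is the integral of `s ↦ ⟨f, u s⟩`. -/
def IsWeakDeriv (p : V →ₗ[ℝ] C(X, ℝ)) (γ : C(ℝ≥0, X)) (u : ℝ → V →L[ℝ] ℝ) : Prop :=
  (∀ f, ∀ t : ℝ≥0, IntegrableOn (fun s => u s f) (Icc 0 t)) ∧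
  ∀ t : ℝ≥0, ∀ f, p f (γ t) - p f (γ 0) = ∫ s in (0 : ℝ)..t, u s f

/-- The paths whose action `∫₀ᵀ sup_f (⟨f, γ̇⟩ - H f γ) ds` is at most `M`. -/
def actionSublevel (p : V →ₗ[ℝ] C(X, ℝ)) (H : V → C(X, ℝ)) (M T : ℝ≥0) : Set C(ℝ≥0, X) :=
  {γ | ∃ u, IsWeakDeriv p γ u ∧ ∫⁻ s in Icc (0 : ℝ) T, legendre H (γ s.toNNReal) (u s) ≤ M}

theorem exists_extension_legendre_le [IsTopologicalAddGroup V] [ContinuousSMul ℝ V]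
    {H : V → C(X, ℝ)} {x : X} (hH : Continuous fun f => H f x) {δ : V →ₗ.[ℝ] ℝ}
    (hdense : Dense (δ.domain : Set V)) {ℓ : ℝ} (hδ : ∀ f : δ.domain, δ f - H f x ≤ ℓ) :
    ∃ u : V →L[ℝ] ℝ, (∀ f : δ.domain, u f = δ f) ∧ legendre H x u ≤ ENNReal.ofReal ℓ := by
  have hcont : Continuous δ := by
    have hnhds : ∀ᶠ f : δ.domain in 𝓝 0, H f x < H 0 x + 1 :=
      (hH.comp continuous_subtype_val).continuousAt.eventually_lt_const (lt_add_one _)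
    refine continuous_linearMap_of_forall_mem_nhds_zero_le (δ := δ.toFun)
      (C := ℓ + (H 0 x + 1)) hnhds fun f hf => ?_
    have := hδ f
    exact (sub_le_iff_le_add.1 this).trans (add_le_add_right (le_of_lt hf) _)
  obtain ⟨u, hu⟩ := exists_continuousLinearMap_extending hdense hcont
  refine ⟨u, hu, iSup_le fun f => ENNReal.ofReal_le_ofReal ?_⟩
  refine hdense.denseRange_val.induction_on (p := fun f => u f - H f x ≤ ℓ) f
    (isClosed_le (u.continuous.sub hH) continuous_const) fun g => ?_
  rw [hu]
  exact hδ g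

theorem ae_dense_domain_derivAlong [TopologicalSpace.SeparableSpace V] {p : V →ₗ[ℝ] C(X, ℝ)}
    {γ : C(ℝ, X)} {μ : Measure ℝ}
    (hdiff : ∀ f, ∀ᵐ s ∂μ, DifferentiableAt ℝ (fun t => p f (γ t)) s) :
    ∀ᵐ s ∂μ, Dense ((derivAlong p γ s).domain : Set V) := by
  filter_upwards [ae_all_iff.2 fun n => hdiff (TopologicalSpace.denseSeq V n)] with s hs
  exact (TopologicalSpace.denseRange_denseSeq V).mono (range_subset_iff.2 hs)

theorem isWeakDeriv_indicator {p : V →ₗ[ℝ] C(X, ℝ)} {γ : C(ℝ≥0, X)} {u : ℝ → V →L[ℝ] ℝ} {T : ℝ≥0}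
    (hγ : ∀ t, T ≤ t → γ t = γ T)
    (hac : ∀ f, AbsolutelyContinuousOnInterval (fun t : ℝ => p f (γ t.toNNReal)) 0 T)
    (hu : ∀ f, ∀ᵐ s ∂volume.restrict (Ioo (0 : ℝ) T),
      u s f = deriv (fun t : ℝ => p f (γ t.toNNReal)) s) :
    IsWeakDeriv p γ ((Ioo (0 : ℝ) T).indicator u) := by
  have hind : ∀ f, (fun s => (Ioo (0 : ℝ) T).indicator u s f) =ᵐ[volume]
      (Ioo (0 : ℝ) T).indicator (deriv fun t : ℝ => p f (γ t.toNNReal)) := fun f => by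
    filter_upwards [(ae_restrict_iff' measurableSet_Ioo).1 (hu f)] with s hs
    by_cases hsT : s ∈ Ioo (0 : ℝ) T
    · simp only [indicator_of_mem hsT, hs hsT]
    · simp only [indicator_of_notMem hsT, zero_apply]
  refine ⟨fun f t => ?_, fun t f => ?_⟩
  · have hint := (intervalIntegrable_iff_integrableOn_Ioo_of_le T.coe_nonneg).1
      (hac f).intervalIntegrable_deriv
    exact (((integrable_indicator_iff measurableSet_Ioo).2 hint).congr (hind f).symm).integrableOn
  · have hmin : γ t = γ (min t T) := by
      rcases le_total t T with h | h
      · rw [min_eq_left h]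
      · rw [min_eq_right h, hγ t h]
    have hacmin : AbsolutelyContinuousOnInterval (fun t : ℝ => p f (γ t.toNNReal)) 0
        (min t T : ℝ≥0) := by
      refine (hac f).mono (uIcc_subset_uIcc_left ?_)
      rw [uIcc_of_le T.coe_nonneg]
      exact ⟨NNReal.coe_nonneg _, NNReal.coe_le_coe.2 (min_le_right _ _)⟩
    have hFTC := hacmin.integral_deriv_eq_sub
    simp only [Real.toNNReal_coe, Real.toNNReal_zero] at hFTC
    rw [hmin, ← hFTC, intervalIntegral.integral_of_le t.coe_nonneg,
      intervalIntegral.integral_of_le (NNReal.coe_nonneg _),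
      integral_congr_ae (ae_restrict_of_ae (hind f)), integral_Ioc_eq_integral_Ioo,
      integral_Ioc_eq_integral_Ioo, setIntegral_indicator measurableSet_Ioo, Ioo_inter_Ioo,
      max_self, NNReal.coe_min]

namespace DominatesAction

variable {p : V →ₗ[ℝ] C(X, ℝ)} {H : V → C(X, ℝ)} {J : Set ℝ} {γ : C(ℝ, X)} {Φ : ℝ → ℝ}
  [IsTopologicalAddGroup V] [ContinuousSMul ℝ V]

theorem exists_functional_eq_deriv (h : DominatesAction p H J γ Φ)
    (hH : ∀ x, Continuous fun f => H f x) {s : ℝ} (hs : J ∈ 𝓝 s) (hΦ : DifferentiableAt ℝ Φ s)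
    (hdense : Dense ((derivAlong p γ s).domain : Set V)) :
    ∃ u : V →L[ℝ] ℝ, (∀ f, DifferentiableAt ℝ (fun t => p f (γ t)) s →
      u f = deriv (fun t => p f (γ t)) s) ∧ legendre H (γ s) u ≤ ENNReal.ofReal (deriv Φ s) := by
  obtain ⟨u, hu, hle⟩ := exists_extension_legendre_le (hH (γ s)) hdense
    fun f => h.deriv_sub_le_deriv hs f.2 hΦ
  exact ⟨u, fun f hf => hu ⟨f, hf⟩, hle⟩

variable [CompactSpace X] [TopologicalSpace.SeparableSpace V]

theorem exists_ae_functional_eq_deriv {a b : ℝ} (hab : a ≤ b)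
    (h : DominatesAction p H (Icc a b) γ Φ) (hH : ∀ x, Continuous fun f => H f x) :
    ∃ u : ℝ → V →L[ℝ] ℝ, ∀ᵐ s ∂volume.restrict (Ioo a b),
      (∀ f, DifferentiableAt ℝ (fun t => p f (γ t)) s → u s f = deriv (fun t => p f (γ t)) s) ∧
        legendre H (γ s) (u s) ≤ ENNReal.ofReal (deriv Φ s) := by
  have hex : ∀ᵐ s ∂volume.restrict (Ioo a b), ∃ u : V →L[ℝ] ℝ,
      (∀ f, DifferentiableAt ℝ (fun t => p f (γ t)) s → u f = deriv (fun t => p f (γ t)) s) ∧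
        legendre H (γ s) u ≤ ENNReal.ofReal (deriv Φ s) := by
    filter_upwards [ae_dense_domain_derivAlong fun f =>
        ae_restrict_Ioo_differentiableAt_of_absolutelyContinuous
          (h.absolutelyContinuousOnInterval hab f),
      ae_restrict_Ioo_differentiableAt_of_monotoneOn h.monotoneOn,
      ae_restrict_mem measurableSet_Ioo] with s hdense hΦ hs
    exact h.exists_functional_eq_deriv hH (Icc_mem_nhds hs.1 hs.2) hΦ hdense
  exact Filter.skolem.1 hex

theorem mem_actionSublevel {γ : C(ℝ≥0, X)} {M T : ℝ≥0}
    (h : DominatesAction p H (Icc 0 T) (γ.comp .realToNNReal) Φ)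
    (hH : ∀ x, Continuous fun f => H f x) (hγ : ∀ t, T ≤ t → γ t = γ T) (hΦ : Φ T - Φ 0 ≤ M) :
    γ ∈ actionSublevel p H M T := by
  have hac := h.absolutelyContinuousOnInterval T.coe_nonneg
  obtain ⟨u, hu⟩ := h.exists_ae_functional_eq_deriv T.coe_nonneg hH
  refine ⟨(Ioo (0 : ℝ) T).indicator u, isWeakDeriv_indicator hγ hac fun f => ?_, ?_⟩
  · filter_upwards [hu, ae_restrict_Ioo_differentiableAt_of_absolutelyContinuous (hac f)]
      with s hs hf using hs.1 f hf
  · calc ∫⁻ s in Icc (0 : ℝ) T, legendre H (γ s.toNNReal) ((Ioo (0 : ℝ) T).indicator u s)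
        = ∫⁻ s in Ioo (0 : ℝ) T, legendre H (γ s.toNNReal) ((Ioo (0 : ℝ) T).indicator u s) :=
          setLIntegral_congr Ioo_ae_eq_Icc.symm
      _ ≤ ∫⁻ s in Ioo (0 : ℝ) T, ENNReal.ofReal (deriv Φ s) := by
          refine lintegral_mono_ae ?_
          filter_upwards [hu, ae_restrict_mem measurableSet_Ioo] with s hs hsT
          rw [indicator_of_mem hsT]
          exact hs.2
      _ ≤ ENNReal.ofReal (Φ T - Φ 0) := lintegral_ofReal_deriv_le T.coe_nonneg h.monotoneOn
      _ ≤ M := ENNReal.ofReal_le_of_le_toReal hΦ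

end DominatesAction

namespace IsWeakDeriv

variable {p : V →ₗ[ℝ] C(X, ℝ)} {γ : C(ℝ≥0, X)} {u : ℝ → V →L[ℝ] ℝ}

theorem intervalIntegrable (hu : IsWeakDeriv p γ u) (f : V) {s t : ℝ} (hs : 0 ≤ s) (ht : 0 ≤ t) :
    IntervalIntegrable (fun r => u r f) volume s t := by
  have (t : ℝ) (ht : 0 ≤ t) : IntervalIntegrable (fun r => u r f) volume 0 t :=
    (intervalIntegrable_iff_integrableOn_Icc_of_le ht).2 (hu.1 f ⟨t, ht⟩)
  exact (this s hs).symm.trans (this t ht)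

theorem sub_eq_integral (hu : IsWeakDeriv p γ u) (f : V) {s t : ℝ} (hs : 0 ≤ s) (ht : 0 ≤ t) :
    p f (γ t.toNNReal) - p f (γ s.toNNReal) = ∫ r in s..t, u r f := by
  rw [← intervalIntegral.integral_interval_sub_left (hu.intervalIntegrable f le_rfl ht)
    (hu.intervalIntegrable f le_rfl hs)]
  have hs' := hu.2 s.toNNReal f
  have ht' := hu.2 t.toNNReal f
  rw [Real.coe_toNNReal _ hs] at hs'
  rw [Real.coe_toNNReal _ ht] at ht'
  linarith

theorem sub_sub_integral_le (hu : IsWeakDeriv p γ u) {H : V → C(X, ℝ)} (f : V) {s t : ℝ}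
    (hs : 0 ≤ s) (hst : s ≤ t)
    (hfin : ∫⁻ r in Ioc s t, legendre H (γ r.toNNReal) (u r) ≠ ⊤) :
    p f (γ t.toNNReal) - p f (γ s.toNNReal) - ∫ r in s..t, H f (γ r.toNNReal) ≤
      (∫⁻ r in Ioc s t, legendre H (γ r.toNNReal) (u r)).toReal := by
  have hint := hu.intervalIntegrable f hs (hs.trans hst)
  have hHint : IntervalIntegrable (fun r => H f (γ r.toNNReal)) volume s t :=
    Continuous.intervalIntegrable (by fun_prop) _ _
  rw [hu.sub_eq_integral f hs (hs.trans hst), ← intervalIntegral.integral_sub hint hHint,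
    intervalIntegral.integral_of_le hst]
  refine (integral_le_toReal_lintegral_ofReal (hint.sub hHint).1).trans ?_
  exact ENNReal.toReal_mono hfin (lintegral_mono fun r => le_iSup_of_le f le_rfl)

end IsWeakDeriv

theorem exists_dominatesAction_of_mem_actionSublevel {p : V →ₗ[ℝ] C(X, ℝ)} {H : V → C(X, ℝ)}
    {M T : ℝ≥0} {γ : C(ℝ≥0, X)} (hγ : γ ∈ actionSublevel p H M T) :
    ∃ Φ : ℝ → ℝ, (∀ t, Φ t ∈ Icc 0 (M : ℝ)) ∧
      DominatesAction p H (Icc 0 T) (γ.comp .realToNNReal) Φ := by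
  obtain ⟨u, hu, haction⟩ := hγ
  set ℓ : ℝ → ℝ≥0∞ := fun r => legendre H (γ r.toNNReal) (u r)
  have hle {t : ℝ} (ht : t ≤ T) : ∫⁻ r in Icc 0 t, ℓ r ≤ M :=
    (lintegral_mono_set (Icc_subset_Icc_right ht)).trans haction
  have hfin {t : ℝ} (ht : t ≤ T) : ∫⁻ r in Icc 0 t, ℓ r ≠ ⊤ :=
    ((hle ht).trans_lt ENNReal.coe_lt_top).ne
  have hincr {s t : ℝ} (hs : s ∈ Icc (0 : ℝ) T) (ht : t ∈ Icc (0 : ℝ) T) (hst : s ≤ t) :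
      ∫⁻ r in Ioc s t, ℓ r ≠ ⊤ ∧ (∫⁻ r in Ioc s t, ℓ r).toReal =
        (∫⁻ r in Icc 0 (min t T), ℓ r).toReal - (∫⁻ r in Icc 0 (min s T), ℓ r).toReal := by
    have hadd := setLIntegral_Icc_add_Ioc (μ := volume) ℓ hs.1 hst
    have hfinst : ∫⁻ r in Ioc s t, ℓ r ≠ ⊤ := ne_top_of_le_ne_top (hfin ht.2)
      (lintegral_mono_set (Ioc_subset_Icc_self.trans (Icc_subset_Icc_left hs.1)))
    rw [min_eq_left hs.2, min_eq_left ht.2, ← hadd, ENNReal.toReal_add (hfin hs.2) hfinst]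
    exact ⟨hfinst, (add_sub_cancel_left _ _).symm⟩
  refine ⟨fun t => (∫⁻ r in Icc 0 (min t T), ℓ r).toReal, fun t => ⟨ENNReal.toReal_nonneg,
    ENNReal.toReal_le_coe_of_le_coe (hle (min_le_right _ _))⟩, ⟨fun s hs t ht hst => ?_,
    fun f s hs t ht hst => ?_⟩⟩
  · exact sub_nonneg.1 ((hincr hs ht hst).2 ▸ ENNReal.toReal_nonneg)
  · obtain ⟨hfinst, hsub⟩ := hincr hs ht hst
    exact hsub ▸ hu.sub_sub_integral_le f hs.1 hst hfinst

end Action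

section ArzelaAscoli

theorem equicontinuous_pi {κ Y ι : Type*} {Z : ι → Type*} [TopologicalSpace Y]
    [∀ i, UniformSpace (Z i)] {F : κ → Y → ∀ i, Z i}
    (hF : ∀ i, Equicontinuous fun k y => F k y i) : Equicontinuous F := by
  rw [Pi.uniformSpace_eq, equicontinuous_iInf_rng]
  intro i
  have hind := @IsUniformInducing.mk _ _ (.comap (Function.eval i) inferInstance) _
    (Function.eval i : (∀ i, Z i) → Z i) rfl
  exact (@IsUniformInducing.equicontinuous_iff _ _ _ _ _ (.comap _ _) _ _ _ hind).2 (hF i)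

theorem equicontinuous_of_mul_dist_le {κ Y Z : Type*} [PseudoMetricSpace Y] [PseudoMetricSpace Z]
    {F : κ → Y → Z} {R : ℝ} (hF : ∀ c > 0, ∃ K : ℝ, ∀ k s t,
      c * dist (F k s) (F k t) ≤ R + K * dist s t) : Equicontinuous F := by
  intro s
  rw [Metric.equicontinuousAt_iff_right]
  intro ε hε
  obtain ⟨K, hK⟩ := hF ((|R| + 1) / ε) (by positivity)
  have htend : Tendsto (fun t => R + K * dist s t) (𝓝 s) (𝓝 R) := by
    have : Continuous fun t => R + K * dist s t := by fun_prop
    simpa using this.tendsto s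
  have hR : R < |R| + 1 := (le_abs_self R).trans_lt (lt_add_one _)
  filter_upwards [htend.eventually_lt_const hR] with t ht k
  have hlt := (hK k s t).trans_lt ht
  rw [div_mul_eq_mul_div, div_lt_iff₀ hε] at hlt
  exact lt_of_mul_lt_mul_left hlt (by positivity)

theorem isCompact_setOf_mul_dist_le {X Y ι : Type*} {Z : ι → Type*} [TopologicalSpace X]
    [CompactSpace X] [PseudoMetricSpace Y] [∀ i, PseudoMetricSpace (Z i)] {p : X → ∀ i, Z i}
    (hp : IsInducing p) (R : ℝ) (K : ℝ → ι → ℝ) :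
    IsCompact {η : C(Y, X) | ∀ c > 0, ∀ i s t,
      c * dist (p (η s) i) (p (η t) i) ≤ R + K c i * dist s t} := by
  let P : (Y → X) → Prop := fun η => ∀ c > 0, ∀ i s t,
    c * dist (p (η s) i) (p (η t) i) ≤ R + K c i * dist s t
  have hequi : Equicontinuous fun (η : {η // P η}) y => p (η.1 y) :=
    equicontinuous_pi fun i => equicontinuous_of_mul_dist_le fun c hc =>
      ⟨K c i, fun η => η.2 c hc i⟩
  have himage : ContinuousMap.toFun '' {η : C(Y, X) | P η} = {η | P η} := by
    refine Subset.antisymm (image_subset_iff.2 fun η hη => hη) fun η hη => ?_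
    exact ⟨⟨η, hp.continuous_iff.2 (hequi.continuous ⟨η, hη⟩)⟩, hη, rfl⟩
  have hclosed : IsClosed {η : Y → X | P η} := by
    have hpi (i : ι) (s : Y) : Continuous fun η : Y → X => p (η s) i :=
      (continuous_apply i).comp (hp.continuous.comp (continuous_apply s))
    simp only [P, ofPred_forall]
    exact isClosed_iInter fun c => isClosed_iInter fun _ => isClosed_iInter fun i =>
      isClosed_iInter fun s => isClosed_iInter fun t => isClosed_le
        (continuous_const.mul ((hpi i s).dist (hpi i t))) continuous_const
  let _ : UniformSpace X := (UniformSpace.comap p inferInstance).replaceTopology hp.eq_induced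
  have hpu : IsUniformInducing p := ⟨rfl⟩
  exact ArzelaAscoli.isCompact_of_equicontinuous _ (himage ▸ hclosed.isCompact)
    (hpu.equicontinuous_iff.2 (hequi.comp fun η : {η : C(Y, X) | P η} => ⟨η.1, η.2⟩))

end ArzelaAscoli

section Compactness

variable {V X : Type*} [AddCommGroup V] [Module ℝ V] [TopologicalSpace X] {p : V →ₗ[ℝ] C(X, ℝ)}
  {H : V → C(X, ℝ)} {J : Set ℝ}

theorem DominatesAction.congr {γ₁ γ₂ : C(ℝ, X)} {Φ : ℝ → ℝ} (hJ : OrdConnected J)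
    (h : DominatesAction p H J γ₁ Φ) (hγ : EqOn γ₁ γ₂ J) : DominatesAction p H J γ₂ Φ where
  monotoneOn := h.monotoneOn
  sub_sub_integral_le f s hs t ht hst := by
    have hint : ∫ r in s..t, H f (γ₁ r) = ∫ r in s..t, H f (γ₂ r) :=
      intervalIntegral.integral_congr fun r hr => congrArg (H f) (hγ (hJ.uIcc_subset hs ht hr))
    rw [← hγ hs, ← hγ ht, ← hint]
    exact h.sub_sub_integral_le f s hs t ht hst

theorem isClosed_setOf_dominatesAction :
    IsClosed {q : C(ℝ, X) × (ℝ → ℝ) | DominatesAction p H J q.1 q.2} := by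
  have hset : {q : C(ℝ, X) × (ℝ → ℝ) | DominatesAction p H J q.1 q.2} =
      {q | MonotoneOn q.2 J} ∩ {q | ∀ f, ∀ s ∈ J, ∀ t ∈ J, s ≤ t →
        p f (q.1 t) - p f (q.1 s) - ∫ r in s..t, H f (q.1 r) ≤ q.2 t - q.2 s} :=
    Set.ext fun q => ⟨fun h => ⟨h.1, h.2⟩, fun h => ⟨h.1, h.2⟩⟩
  rw [hset]
  refine IsClosed.inter ?_ ?_
  · simp only [MonotoneOn, ofPred_forall]
    exact isClosed_iInter fun s => isClosed_iInter fun _ => isClosed_iInter fun t =>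
      isClosed_iInter fun _ => isClosed_iInter fun _ => isClosed_le (by fun_prop) (by fun_prop)
  · simp only [ofPred_forall]
    refine isClosed_iInter fun f => isClosed_iInter fun s => isClosed_iInter fun _ =>
      isClosed_iInter fun t => isClosed_iInter fun _ => isClosed_iInter fun _ =>
      isClosed_le ?_ (by fun_prop)
    have hint : Continuous fun q : C(ℝ, X) × (ℝ → ℝ) => ∫ r in s..t, H f (q.1 r) :=
      intervalIntegral.continuous_parametric_intervalIntegral_of_continuous'
        (by unfold Function.uncurry; fun_prop) s t
    exact .sub (by fun_prop) hint

instance fact_zero_le (T : ℝ≥0) : Fact (0 ≤ T) :=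
  ⟨zero_le⟩

/-- The paths on `[0, T]`, extended by constants, together with a primitive of their action taking
values in `[0, M]`. -/
def dominatedPairs (p : V →ₗ[ℝ] C(X, ℝ)) (H : V → C(X, ℝ)) (M : ℝ) (T : ℝ≥0) :
    Set (C(Icc 0 T, X) × (ℝ → ℝ)) :=
  {q | (∀ t, q.2 t ∈ Icc 0 M) ∧
    DominatesAction p H (Icc 0 T) ((ContinuousMap.IccExtendCM q.1).comp .realToNNReal) q.2}

theorem isCompact_dominatedPairs [CompactSpace X] (hp : IsInducing fun x (f : V) => p f x) (M : ℝ)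
    (T : ℝ≥0) : IsCompact (dominatedPairs p H M T) := by
  refine ((isCompact_setOf_mul_dist_le (Y := Icc 0 T) hp M fun c f =>
    max ‖H (c • f)‖ ‖H (-(c • f))‖).prod
      (isCompact_univ_pi fun _ : ℝ => isCompact_Icc (a := 0) (b := M))).of_isClosed_subset ?_ ?_
  · have hrange : IsClosed {q : C(Icc 0 T, X) × (ℝ → ℝ) | ∀ t, q.2 t ∈ Icc 0 M} := by
      simp only [ofPred_forall]
      exact isClosed_iInter fun t => isClosed_Icc.preimage (by fun_prop)
    refine hrange.inter (isClosed_setOf_dominatesAction.preimage (.prodMk ?_ continuous_snd))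
    exact (ContinuousMap.continuous_precomp _).comp
      (ContinuousMap.IccExtendCM.continuous.comp continuous_fst)
  · rintro ⟨η, Φ⟩ ⟨hΦ, h⟩
    refine ⟨fun c hc f s t => ?_, fun t _ => hΦ t⟩
    have hmem (r : Icc 0 T) : (r : ℝ) ∈ Icc (0 : ℝ) T :=
      ⟨NNReal.coe_nonneg _, NNReal.coe_le_coe.2 r.2.2⟩
    have hext (r : Icc 0 T) :
        (ContinuousMap.IccExtendCM η).comp .realToNNReal (r : ℝ) = η r :=
      (congrArg (ContinuousMap.IccExtendCM η) Real.toNNReal_coe).trans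
        (ContinuousMap.IccExtendCM_of_mem r.2)
    have hle := h.mul_dist_le hc f (hmem s) (hmem t)
    rw [hext, hext] at hle
    refine hle.trans (add_le_add_left ?_ _)
    exact (Real.dist_le_of_mem_Icc (hΦ s) (hΦ t)).trans_eq (sub_zero M)

theorem restrict_image_actionSublevel [TopologicalSpace V] [IsTopologicalAddGroup V]
    [ContinuousSMul ℝ V] [TopologicalSpace.SeparableSpace V] [CompactSpace X]
    (hH : ∀ x, Continuous fun f => H f x) (M T : ℝ≥0) :
    (fun γ : C(ℝ≥0, X) => γ.restrict (Icc 0 T)) '' actionSublevel p H M T =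
      Prod.fst '' dominatedPairs p H M T := by
  ext η
  constructor
  · rintro ⟨γ, hγ, rfl⟩
    obtain ⟨Φ, hΦ, h⟩ := exists_dominatesAction_of_mem_actionSublevel hγ
    refine ⟨(γ.restrict (Icc 0 T), Φ), ⟨hΦ, h.congr ordConnected_Icc fun t ht => ?_⟩, rfl⟩
    exact (ContinuousMap.IccExtendCM_of_mem (f := γ.restrict (Icc 0 T))
      ⟨zero_le, Real.toNNReal_le_iff_le_coe.2 ht.2⟩).symm
  · rintro ⟨⟨η, Φ⟩, ⟨hΦ, h⟩, rfl⟩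
    refine ⟨ContinuousMap.IccExtendCM η, h.mem_actionSublevel hH (fun t ht => ?_) ?_,
      ContinuousMap.ext fun t => ContinuousMap.IccExtendCM_of_mem t.2⟩
    · exact congrArg η ((projIcc_of_right_le zero_le ht).trans (projIcc_right zero_le).symm)
    · linarith [(hΦ T).2, (hΦ 0).1]

end Compactness

section Integration

variable {E : Type*} [TopologicalSpace E] [CompactSpace E] [MeasurableSpace E]
  [OpensMeasurableSpace E]

theorem integrable_continuousMap (g : C(E, ℝ)) (μ : Measure E) [IsFiniteMeasure μ] :
    Integrable g μ :=
  (BoundedContinuousFunction.mkOfCompact g).integrable μ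

/-- The integral of a continuous function, as a continuous function of the probability measure. -/
noncomputable def integralC : C(E, ℝ) →ₗ[ℝ] C(ProbabilityMeasure E, ℝ) where
  toFun g :=
    { toFun := fun μ => ∫ x, g x ∂(μ : Measure E)
      continuous_toFun := continuous_iff_continuousAt.2 fun _ =>
        ProbabilityMeasure.tendsto_iff_forall_integral_tendsto.1 tendsto_id
          (BoundedContinuousFunction.mkOfCompact g) }
  map_add' g h := ContinuousMap.ext fun μ =>
    integral_add (integrable_continuousMap g μ) (integrable_continuousMap h μ)
  map_smul' c g := ContinuousMap.ext fun _ => integral_const_mul c g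

theorem norm_integralC_apply_le (g : C(E, ℝ)) (μ : ProbabilityMeasure E) :
    ‖integralC g μ‖ ≤ ‖g‖ := by
  have hle := norm_integral_le_of_norm_le_const (μ := (μ : Measure E))
    (Eventually.of_forall fun x => g.norm_coe_le_norm x)
  rwa [probReal_univ, mul_one] at hle

theorem continuous_integralC_apply (μ : ProbabilityMeasure E) :
    Continuous fun g : C(E, ℝ) => integralC g μ := by
  refine (LipschitzWith.of_dist_le_mul (K := 1) fun g h => ?_).continuous
  rw [dist_eq_norm, dist_eq_norm, NNReal.coe_one, one_mul, ← ContinuousMap.sub_apply, ← map_sub]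
  exact norm_integralC_apply_le (g - h) μ

theorem isInducing_integralC_of_denseRange {E : Type*} [TopologicalSpace E] [CompactSpace E]
    [T2Space E] [MeasurableSpace E] [BorelSpace E] [HasOuterApproxClosed E] {ι : Type*}
    {e : ι → C(E, ℝ)} (he : DenseRange e) :
    IsInducing fun (μ : ProbabilityMeasure E) i => integralC (e i) μ := by
  have hcont : Continuous fun (μ : ProbabilityMeasure E) i => integralC (e i) μ := by fun_prop
  refine (hcont.isClosedEmbedding fun μ ν hμν => ?_).isInducing
  have hint (f : BoundedContinuousFunction E ℝ) :
      ∫ x, f x ∂(μ : Measure E) = ∫ x, f x ∂(ν : Measure E) :=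
    congrFun (he.equalizer (continuous_integralC_apply μ) (continuous_integralC_apply ν) hμν)
      (f : C(E, ℝ))
  have hmeas : (μ : Measure E) = ν := ext_of_forall_integral_eq_of_IsFiniteMeasure hint
  exact Subtype.ext hmeas

end Integration

section Hamiltonian

variable {E : Type*} [TopologicalSpace E] [CompactSpace E] {S : FellerSemigroup E}
  {D : Submodule ℝ C(E, ℝ)}

open CoreSpace

theorem FellerSemigroup.generator_add_one (S : FellerSemigroup E) (g : C(E, ℝ)) :
    S.generator (g + 1) = S.generator g := by
  simp only [FellerSemigroup.generator, map_add, S.op_one]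
  exact derivWithin_add_const _

theorem IsRegularCore.continuous_hamiltonian [TopologicalSpace (CoreSpace D)]
    [IsTopologicalAddGroup (CoreSpace D)] (hD : IsRegularCore S D) :
    Continuous fun f : CoreSpace D => S.hamiltonian (incl f) := by
  have hexp : Continuous fun f : CoreSpace D => expC (incl f) := by
    refine ((hD.continuous_incl.comp hD.continuous_exp).add_const 1).congr fun f => ?_
    rw [Function.comp_apply, incl_mk, sub_add_cancel]
  have hexp_neg : Continuous fun f : CoreSpace D => expC (-incl f) :=
    (hexp.comp continuous_neg).congr fun f => by rw [Function.comp_apply, map_neg]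
  have hgen : Continuous fun f : CoreSpace D => S.generator (expC (incl f)) := by
    refine (hD.continuous_generator.comp hD.continuous_exp).congr fun f => ?_
    rw [Function.comp_apply, incl_mk, ← S.generator_add_one, sub_add_cancel]
  exact hexp_neg.mul hgen

theorem IsSmoothCore.denseRange_incl (hD : IsSmoothCore S D) :
    DenseRange (incl : CoreSpace D → C(E, ℝ)) :=
  hD.dense.denseRange_val

theorem levelSet_eq_actionSublevel [TopologicalSpace (CoreSpace D)] [MeasurableSpace E]
    [BorelSpace E] (M : ℝ) (T : ℝ≥0) :
    levelSet S D M T = actionSublevel (integralC ∘ₗ (incl : CoreSpace D →ₗ[ℝ] C(E, ℝ)))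
      (fun f => integralC (S.hamiltonian (incl f))) M.toNNReal T :=
  rfl

end Hamiltonian

end PathLD

theorem mainTheorem4_general {V X : Type*} [AddCommGroup V] [Module ℝ V] [TopologicalSpace V]
    [IsTopologicalAddGroup V] [ContinuousSMul ℝ V] [TopologicalSpace.SeparableSpace V]
    [TopologicalSpace X] [CompactSpace X] {p : V →ₗ[ℝ] C(X, ℝ)}
    (hp : IsInducing fun x (f : V) => p f x) {H : V → C(X, ℝ)}
    (hH : ∀ x, Continuous fun f => H f x) (M T : ℝ≥0) :
    IsCompact ((fun γ : C(ℝ≥0, X) => γ.restrict (Icc 0 T)) '' PathLD.actionSublevel p H M T) := by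
  rw [PathLD.restrict_image_actionSublevel hH]
  exact (PathLD.isCompact_dominatedPairs hp M T).image continuous_fst

theorem mainTheorem4 {E : Type*} [MetricSpace E] [CompactSpace E] [MeasurableSpace E]
    [BorelSpace E] (S : PathLD.FellerSemigroup E) (D : Submodule ℝ C(E, ℝ))
    [TopologicalSpace (PathLD.CoreSpace D)] [IsTopologicalAddGroup (PathLD.CoreSpace D)]
    [ContinuousSMul ℝ (PathLD.CoreSpace D)] [LocallyConvexSpace ℝ (PathLD.CoreSpace D)]
    [T2Space (PathLD.CoreSpace D)] [TopologicalSpace.SeparableSpace (PathLD.CoreSpace D)]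
    [BarrelledSpace ℝ (PathLD.CoreSpace D)] (hD : PathLD.IsRegularCore S D)
    (M : ℝ) (hM : 0 < M) (T : ℝ≥0) :
    IsCompact ((fun ν : C(ℝ≥0, ProbabilityMeasure E) => ν.restrict (Set.Icc 0 T)) ''
      PathLD.levelSet S D M T) := by
  have hp : IsInducing fun (μ : ProbabilityMeasure E) (f : PathLD.CoreSpace D) =>
      PathLD.integralC (PathLD.CoreSpace.incl f) μ :=
    PathLD.isInducing_integralC_of_denseRange hD.denseRange_incl
  have hH (μ : ProbabilityMeasure E) : Continuous fun f : PathLD.CoreSpace D =>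
      PathLD.integralC (S.hamiltonian (PathLD.CoreSpace.incl f)) μ :=
    (PathLD.continuous_integralC_apply μ).comp hD.continuous_hamiltonian
  rw [PathLD.levelSet_eq_actionSublevel]
  exact mainTheorem4_general hp hH M.toNNReal T
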